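/- A \emph{GBI-algebra} is a Heyting algebra $(A,\wedge,\vee,\to,\top,\bot)$ together with a monoid $(A,\cdot,1)$ and operations $\backslash,/$ such that $xy\le z\iff y\le x\backslash z\iff x\le z/y$; GBI-homomorphisms preserve all operations. An \emph{Esakia space} $(P,\le,\tau)$ is a poset with a compact topology with a base of clopen sets, such that for all $p\nleq q$ some clopen upset contains $p$ but not $q$, and such that ${\downarrow}U$ is clopen whenever $U$ is clopen. For $\circ:P^2\to\mathcal P(P)$ put $X\circ Y=\bigcup_{x\in X,y\in Y}x\circ y$ (identifying a point with its singleton), $X\cdot Y={\uparrow}(X\circ Y)$, $X\backslash Y=\{z: X\circ z\subseteq Y\}$ and $X/Y=\{z: z\circ Y\subseteq X\}$. A \emph{GBI-space} $(P,\le,\circ,E,\tau)$ is an Esakia space with $\circ:P^2\to\mathcal P(P)$ and $E\subseteq P$ such that (1) $(x\circ y)\circ z=x\circ(y\circ z)$; (2) $E$ is a clopen upset and $E\circ U=U=U\circ E$ for every clopen upset $U$; (3) $x'\le x$, $y'\le y$, $z\le z'$ and $z\in x\circ y$ imply $z'\in x'\circ y'$; (4) $U\circ V$, $U\backslash V$ and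 $U/V$ are clopen for all clopen upsets $U,V$; (5) if $z\notin x\circ y$, there are clopen upsets $U\ni x$, $V\ni y$ with $z\notin U\circ V$. A \emph{GBI-p-morphism} $f:P\to Q$ of GBI-spaces is a continuous map with ${\uparrow}f(p)=f[{\uparrow}p]$ for all $p\in P$ such that (6) $z\in x\circ y\Rightarrow f(z)\in f(x)\circ f(y)$; (7) $f(z)\in u\circ v\Rightarrow\exists x,y\in P\,(u\le f(x),\ v\le f(y),\ z\in x\circ y)$; (8) $w\in f(x)\circ v\Rightarrow\exists y,z\in P\,(v\le f(y),\ f(z)\le w,\ z\in x\circ y)$; (9) $w\in u\circ f(y)\Rightarrow\exists x,z\in P\,(u\le f(x),\ f(z)\le w,\ z\in x\circ y)$; (10) $E_P=f^{-1}[E_Q]$. For a GBI-algebra $A$ let $F_p(A)$ be the set of (proper) prime filters of $A$, ordered by inclusion, with the topology that has as a subbasis the sets $\mathcal F_a=\{F: a\in F\}$ and their complements ($a\in A$), with $F\circ G=\bigcap_{a\in F,b\in G}\mathcal F_{ab}$ and $E=\mathcal F_1$. For a GBI-space $P$ let $U_c(P)$ be the set of clopen upsets of $P$ with the operations $\cap,\cup,\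 U\to V=P\setminus{\downarrow}(U\setminus V),\ \top=P,\ \bot=\emptyset,\ \cdot,\backslash,/$ and unit $E$. On morphisms let $F_p(h)(G)=h^{-1}[G]$ and $U_c(f)(V)=f^{-1}[V]$. \textbf{Theorem.} (i) For every GBI-algebra $A$, $F_p(A)$ is a GBI-space. (ii) For every GBI-space $P$, $U_c(P)$ is a GBI-algebra. (iii) $U_c(F_p(A))\cong A$ for every GBI-algebra $A$ and $F_p(U_c(P))\cong P$ for every GBI-space $P$. (iv) $F_p$ sends GBI-homomorphisms to GBI-p-morphisms and $U_c$ sends GBI-p-morphisms to GBI-homomorphisms, so that they are contravariant functors; $U_cF_p$ and $F_pU_c$ are naturally isomorphic to the respective identity functors, through $a\mapsto\mathcal F_a$ and $x\mapsto\{U\in U_c(P): x\in U\}$. Hence the category of GBI-algebras with GBI-homomorphisms is dually equivalent, through $F_p$ and $U_c$, to the category of GBI-spaces with GBI-p-morphisms. -/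

import Mathlib

open CategoryTheory Opposite

universe u

/-! ### GBI-algebras -/

/-- The operations `·`, `1`, `\`, `/` that a GBI-algebra adds to its Heyting algebra. -/
class GBIOps (A : Type u) extends Mul A, One A where
  /-- The left residual: `ldiv x z` is `x \ z`. -/
  ldiv : A → A → A
  /-- The right residual: `rdiv z y` is `z / y`. -/
  rdiv : A → A → A

/-- A GBI-algebra: a Heyting algebra with a monoid structure and both residuals of its product. -/
class GBIAlgebra (A : Type u) [HeytingAlgebra A] [GBIOps A] : Prop where
  mul_assoc : ∀ x y z : A, x * y * z = x * (y * z)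
  one_mul : ∀ x : A, 1 * x = x
  mul_one : ∀ x : A, x * 1 = x
  mul_le_iff_le_ldiv : ∀ x y z : A, x * y ≤ z ↔ y ≤ GBIOps.ldiv x z
  mul_le_iff_le_rdiv : ∀ x y z : A, x * y ≤ z ↔ x ≤ GBIOps.rdiv z y

/-- GBI-homomorphisms preserve all the operations (that `⊤` is preserved follows). -/
structure IsGBIHom {A B : Type u} [HeytingAlgebra A] [GBIOps A] [HeytingAlgebra B]
    [GBIOps B] (h : A → B) : Prop where
  map_inf : ∀ x y, h (x ⊓ y) = h x ⊓ h y
  map_sup : ∀ x y, h (x ⊔ y) = h x ⊔ h y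
  map_himp : ∀ x y, h (x ⇨ y) = h x ⇨ h y
  map_bot : h ⊥ = ⊥
  map_mul : ∀ x y, h (x * y) = h x * h y
  map_ldiv : ∀ x y, h (GBIOps.ldiv x y) = GBIOps.ldiv (h x) (h y)
  map_rdiv : ∀ x y, h (GBIOps.rdiv x y) = GBIOps.rdiv (h x) (h y)
  map_one : h 1 = 1

theorem IsGBIHom.map_top {A B : Type u} [HeytingAlgebra A] [GBIOps A]
    [HeytingAlgebra B] [GBIOps B] {h : A → B} (hh : IsGBIHom h) : h ⊤ = ⊤ := by
  rw [← himp_self (a := (⊥ : A)), hh.map_himp, himp_self]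

theorem IsGBIHom.monotone {A B : Type u} [HeytingAlgebra A] [GBIOps A]
    [HeytingAlgebra B] [GBIOps B] {h : A → B} (hh : IsGBIHom h) : Monotone h := by
  intro x y hxy
  rw [← inf_eq_left, ← hh.map_inf, inf_eq_left.2 hxy]

theorem IsGBIHom.id (A : Type u) [HeytingAlgebra A] [GBIOps A] : IsGBIHom (fun a : A => a) := by
  constructor <;> intros <;> rfl

theorem IsGBIHom.comp {A B C : Type u} [HeytingAlgebra A] [GBIOps A] [HeytingAlgebra B] [GBIOps B]
    [HeytingAlgebra C] [GBIOps C] {g : B → C} {h : A → B} (hg : IsGBIHom g) (hh : IsGBIHom h) :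
    IsGBIHom (fun a => g (h a)) where
  map_inf x y := by rw [hh.map_inf, hg.map_inf]
  map_sup x y := by rw [hh.map_sup, hg.map_sup]
  map_himp x y := by rw [hh.map_himp, hg.map_himp]
  map_bot := by rw [hh.map_bot, hg.map_bot]
  map_mul x y := by rw [hh.map_mul, hg.map_mul]
  map_ldiv x y := by rw [hh.map_ldiv, hg.map_ldiv]
  map_rdiv x y := by rw [hh.map_rdiv, hg.map_rdiv]
  map_one := by rw [hh.map_one, hg.map_one]

/-- Bundled GBI-algebras. -/
structure GBIAlg where
  carrier : Type u
  [heyting : HeytingAlgebra carrier]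
  [ops : GBIOps carrier]
  [isGBI : GBIAlgebra carrier]

attribute [instance] GBIAlg.heyting GBIAlg.ops GBIAlg.isGBI

instance : CoeSort GBIAlg.{u} (Type u) := ⟨GBIAlg.carrier⟩

/-- Bundled GBI-homomorphisms. -/
@[ext]
structure GBIHom (A B : GBIAlg.{u}) where
  toFun : A → B
  isHom : IsGBIHom toFun

/-- The category of GBI-algebras with GBI-homomorphisms. -/
instance : Category GBIAlg.{u} where
  Hom A B := GBIHom A B
  id A := ⟨fun a => a, IsGBIHom.id A⟩
  comp f g := ⟨fun a => g.toFun (f.toFun a), g.isHom.comp f.isHom⟩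

/-! ### GBI-spaces -/

/-- An Esakia space: a (compact) Priestley space in which the downset of a clopen set is clopen. -/
class EsakiaSpace (P : Type u) [PartialOrder P] [TopologicalSpace P] : Prop
    extends CompactSpace P, PriestleySpace P where
  isTopologicalBasis_isClopen : TopologicalSpace.IsTopologicalBasis {U : Set P | IsClopen U}
  isClopen_lowerClosure : ∀ U : Set P, IsClopen U → IsClopen (lowerClosure U : Set P)

/-- A ternary relation `∘ : P² → 𝒫(P)` and a unary relation `E ⊆ P`. -/
class GBIFrame (P : Type u) where
  circ : P → P → Set P
  E : Set P

namespace GBIFrame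

variable {P : Type u} [GBIFrame P]

/-- `X ∘ Y`, the union of all `x ∘ y` with `x ∈ X` and `y ∈ Y`. -/
def setCirc (X Y : Set P) : Set P := ⋃ x ∈ X, ⋃ y ∈ Y, circ x y

/-- `X · Y = ↑(X ∘ Y)`. -/
def setMul [Preorder P] (X Y : Set P) : Set P := (upperClosure (setCirc X Y) : Set P)

/-- `X \ Y = {z : X ∘ z ⊆ Y}`. -/
def setLdiv (X Y : Set P) : Set P := {z | setCirc X {z} ⊆ Y}

/-- `X / Y = {z : z ∘ Y ⊆ X}`. -/
def setRdiv (X Y : Set P) : Set P := {z | setCirc {z} Y ⊆ X}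

end GBIFrame

open GBIFrame in
/-- A GBI-space. -/
class GBISpace (P : Type u) [PartialOrder P] [TopologicalSpace P] [GBIFrame P] : Prop
    extends EsakiaSpace P where
  circ_assoc : ∀ x y z : P, setCirc (circ x y) {z} = setCirc {x} (circ y z)
  isClopen_E : IsClopen (E : Set P)
  isUpperSet_E : IsUpperSet (E : Set P)
  E_circ : ∀ U : Set P, IsClopen U → IsUpperSet U → setCirc E U = U
  circ_E : ∀ U : Set P, IsClopen U → IsUpperSet U → setCirc U E = U
  circ_mono : ∀ x x' y y' z z' : P, x' ≤ x → y' ≤ y → z ≤ z' → z ∈ circ x y → z' ∈ circ x' y'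
  isClopen_setCirc : ∀ U V : Set P, IsClopen U → IsUpperSet U → IsClopen V → IsUpperSet V →
    IsClopen (setCirc U V)
  isClopen_setLdiv : ∀ U V : Set P, IsClopen U → IsUpperSet U → IsClopen V → IsUpperSet V →
    IsClopen (setLdiv U V)
  isClopen_setRdiv : ∀ U V : Set P, IsClopen U → IsUpperSet U → IsClopen V → IsUpperSet V →
    IsClopen (setRdiv U V)
  exists_of_notMem_circ : ∀ x y z : P, z ∉ circ x y → ∃ U V : Set P,
    IsClopen U ∧ IsUpperSet U ∧ IsClopen V ∧ IsUpperSet V ∧ x ∈ U ∧ y ∈ V ∧ z ∉ setCirc U V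

open GBIFrame in
/-- A GBI-p-morphism: a continuous p-morphism (`↑f(p) = f[↑p]`) compatible with `∘` and `E`. -/
structure IsGBIPMorphism {P Q : Type u} [PartialOrder P] [TopologicalSpace P]
    [GBIFrame P] [PartialOrder Q] [TopologicalSpace Q] [GBIFrame Q] (f : P → Q) : Prop where
  continuous : Continuous f
  image_Ici : ∀ p, Set.Ici (f p) = f '' Set.Ici p
  map_circ : ∀ x y z : P, z ∈ circ x y → f z ∈ circ (f x) (f y)
  exists_of_map_mem : ∀ (z : P) (u v : Q), f z ∈ circ u v →
    ∃ x y : P, u ≤ f x ∧ v ≤ f y ∧ z ∈ circ x y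
  exists_of_mem_left : ∀ (x : P) (v w : Q), w ∈ circ (f x) v →
    ∃ y z : P, v ≤ f y ∧ f z ≤ w ∧ z ∈ circ x y
  exists_of_mem_right : ∀ (y : P) (u w : Q), w ∈ circ u (f y) →
    ∃ x z : P, u ≤ f x ∧ f z ≤ w ∧ z ∈ circ x y
  preimage_E : (E : Set P) = f ⁻¹' E

section PMorphism

variable {P Q R : Type u} [PartialOrder P] [TopologicalSpace P] [GBIFrame P]
  [PartialOrder Q] [TopologicalSpace Q] [GBIFrame Q] [PartialOrder R] [TopologicalSpace R]
  [GBIFrame R]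

theorem IsGBIPMorphism.monotone {f : P → Q} (hf : IsGBIPMorphism f) : Monotone f := by
  intro x y hxy
  have : f y ∈ Set.Ici (f x) := by
    rw [hf.image_Ici]
    exact ⟨y, hxy, rfl⟩
  exact this

theorem IsGBIPMorphism.id : IsGBIPMorphism (fun p : P => p) where
  continuous := continuous_id
  image_Ici p := by simp
  map_circ _ _ _ h := h
  exists_of_map_mem _ u v h := ⟨u, v, le_rfl, le_rfl, h⟩
  exists_of_mem_left _ v w h := ⟨v, w, le_rfl, le_rfl, h⟩
  exists_of_mem_right _ u w h := ⟨u, w, le_rfl, le_rfl, h⟩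
  preimage_E := rfl

theorem IsGBIPMorphism.comp {g : Q → R} {f : P → Q} (hg : IsGBIPMorphism g)
    (hf : IsGBIPMorphism f) : IsGBIPMorphism (fun p => g (f p)) where
  continuous := hg.continuous.comp hf.continuous
  image_Ici p := by rw [hg.image_Ici, hf.image_Ici, Set.image_image]
  map_circ x y z h := hg.map_circ _ _ _ (hf.map_circ _ _ _ h)
  exists_of_map_mem z u v h := by
    obtain ⟨x', y', hx', hy', h'⟩ := hg.exists_of_map_mem _ _ _ h
    obtain ⟨x, y, hx, hy, h''⟩ := hf.exists_of_map_mem _ _ _ h'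
    exact ⟨x, y, hx'.trans (hg.monotone hx), hy'.trans (hg.monotone hy), h''⟩
  exists_of_mem_left x v w h := by
    obtain ⟨y', z', hy', hz', h'⟩ := hg.exists_of_mem_left _ _ _ h
    obtain ⟨y, z, hy, hz, h''⟩ := hf.exists_of_mem_left _ _ _ h'
    exact ⟨y, z, hy'.trans (hg.monotone hy), (hg.monotone hz).trans hz', h''⟩
  exists_of_mem_right y u w h := by
    obtain ⟨x', z', hx', hz', h'⟩ := hg.exists_of_mem_right _ _ _ h
    obtain ⟨x, z, hx, hz, h''⟩ := hf.exists_of_mem_right _ _ _ h'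
    exact ⟨x, z, hx'.trans (hg.monotone hx), (hg.monotone hz).trans hz', h''⟩
  preimage_E := by rw [hf.preimage_E, hg.preimage_E]; rfl

end PMorphism

/-- Bundled GBI-spaces. -/
structure GBISp where
  carrier : Type u
  [order : PartialOrder carrier]
  [top : TopologicalSpace carrier]
  [frame : GBIFrame carrier]
  [isGBI : GBISpace carrier]

attribute [instance] GBISp.order GBISp.top GBISp.frame GBISp.isGBI

instance : CoeSort GBISp.{u} (Type u) := ⟨GBISp.carrier⟩

/-- Bundled GBI-p-morphisms. -/
@[ext]
structure GBIPMorphism (P Q : GBISp.{u}) where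
  toFun : P → Q
  isPMorphism : IsGBIPMorphism toFun

/-- The category of GBI-spaces with GBI-p-morphisms. -/
instance : Category GBISp.{u} where
  Hom P Q := GBIPMorphism P Q
  id _ := ⟨fun p => p, IsGBIPMorphism.id⟩
  comp f g := ⟨fun p => g.toFun (f.toFun p), g.isPMorphism.comp f.isPMorphism⟩

/-! ### Prime filters -/

/-- The prime filters of a lattice. Mathlib's `Order.PFilter.IsPrime` asks that the complement
be an ideal, in particular non-empty, so prime filters are proper. -/
def PrimeFilter (A : Type u) [Lattice A] : Type u := {F : Order.PFilter A // F.IsPrime}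

namespace PrimeFilter

variable {A : Type u} [Lattice A]

instance : Membership A (PrimeFilter A) := ⟨fun F a => a ∈ F.1⟩

/-- Prime filters are ordered by inclusion. -/
instance : PartialOrder (PrimeFilter A) where
  le F G := ∀ a : A, a ∈ F → a ∈ G
  le_refl _ _ h := h
  le_trans _ _ _ h h' a ha := h' a (h a ha)
  le_antisymm _ _ h h' := Subtype.ext (SetLike.ext fun a => ⟨h a, h' a⟩)

/-- `ℱ_a`, the set of prime filters that contain `a`. -/
def basic (a : A) : Set (PrimeFilter A) := {F | a ∈ F}

/-- The topology with the sets `ℱ_a` and their complements as a subbasis. -/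
instance : TopologicalSpace (PrimeFilter A) :=
  TopologicalSpace.generateFrom
    (Set.range (fun a : A => basic a) ∪ Set.range (fun a : A => (basic a)ᶜ))

/-- `F ∘ G = ⋂_{a ∈ F, b ∈ G} ℱ_{ab}` and `E = ℱ_1`. -/
instance {A : Type u} [HeytingAlgebra A] [GBIOps A] : GBIFrame (PrimeFilter A) where
  circ F G := ⋂ a ∈ F, ⋂ b ∈ G, basic (a * b)
  E := basic 1

/-- The preimage `h⁻¹[G]` of a prime filter under a GBI-homomorphism. -/
def comap {A B : Type u} [HeytingAlgebra A] [GBIOps A] [HeytingAlgebra B] [GBIOps B]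
    {h : A → B} (hh : IsGBIHom h) (G : PrimeFilter B) : PrimeFilter A :=
  ⟨Order.IsPFilter.toPFilter (F := {a | h a ∈ G.1}) <| Order.IsPFilter.of_def
      ⟨⊤, by
        change h ⊤ ∈ G.1
        rw [hh.map_top]
        exact Order.PFilter.top_mem⟩
      (fun x hx y hy => ⟨x ⊓ y, by
        change h (x ⊓ y) ∈ G.1
        rw [hh.map_inf]
        exact Order.PFilter.inf_mem hx hy, inf_le_left, inf_le_right⟩)
      (fun hxy hx => Order.PFilter.mem_of_le (hh.monotone hxy) hx), by
    have hG := G.2.compl_ideal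
    refine ⟨⟨?_, ⟨⊥, ?_⟩, ?_⟩⟩
    · intro a b hba ha hb
      have hb' : h b ∈ G.1 := hb
      have ha' : h a ∈ G.1 := Order.PFilter.mem_of_le (hh.monotone hba) hb'
      exact ha ha'
    · obtain ⟨b, hb⟩ := hG.Nonempty
      intro hbot
      have hbot' : h ⊥ ∈ G.1 := hbot
      rw [hh.map_bot] at hbot'
      exact hb (Order.PFilter.mem_of_le bot_le hbot')
    · intro x hx y hy
      obtain ⟨c, hc, hxc, hyc⟩ := hG.Directed (h x) hx (h y) hy
      refine ⟨x ⊔ y, ?_, le_sup_left, le_sup_right⟩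
      intro hxy
      have hxy' : h (x ⊔ y) ∈ G.1 := hxy
      rw [hh.map_sup] at hxy'
      exact hc (Order.PFilter.mem_of_le (sup_le hxc hyc) hxy')⟩

theorem mem_comap {A B : Type u} [HeytingAlgebra A] [GBIOps A] [HeytingAlgebra B]
    [GBIOps B] {h : A → B} (hh : IsGBIHom h) (G : PrimeFilter B) (a : A) :
    a ∈ comap hh G ↔ h a ∈ G := Iff.rfl

theorem ext {F G : PrimeFilter A} (h : ∀ a, a ∈ F ↔ a ∈ G) : F = G :=
  Subtype.ext (SetLike.ext h)

end PrimeFilter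

/-! ### Clopen upsets -/

namespace ClopenUpperSet

variable {P : Type u} [PartialOrder P] [TopologicalSpace P]

/-- The clopen upsets of an Esakia space, with `U → V = P - ↓(U - V)`; the lattice operations are
intersection and union. -/
instance [EsakiaSpace P] : HeytingAlgebra (ClopenUpperSet P) :=
  { (inferInstance : Lattice (ClopenUpperSet P)),
    (inferInstance : BoundedOrder (ClopenUpperSet P)) with
    himp := fun U V =>
      ⟨⟨((lowerClosure ((U : Set P) \ V) : LowerSet P) : Set P)ᶜ,
        (EsakiaSpace.isClopen_lowerClosure _ (U.isClopen.diff V.isClopen)).compl⟩,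
        (lowerClosure ((U : Set P) \ V)).lower.compl⟩
    compl := fun U =>
      ⟨⟨((lowerClosure ((U : Set P) \ (⊥ : ClopenUpperSet P)) : LowerSet P) : Set P)ᶜ,
        (EsakiaSpace.isClopen_lowerClosure _
          (U.isClopen.diff (⊥ : ClopenUpperSet P).isClopen)).compl⟩,
        (lowerClosure ((U : Set P) \ (⊥ : ClopenUpperSet P))).lower.compl⟩
    le_himp_iff := by
      intro W U V
      constructor
      · rintro h x ⟨hxW, hxU⟩
        by_contra hxV
        exact h hxW (subset_lowerClosure ⟨hxU, hxV⟩)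
      · rintro h x hxW ⟨y, ⟨hyU, hyV⟩, hxy⟩
        exact hyV (h ⟨W.upper hxy hxW, hyU⟩)
    himp_bot := fun _ => rfl }

open GBIFrame

theorem isUpperSet_setCirc [GBIFrame P] [GBISpace P] (X Y : Set P) :
    IsUpperSet (setCirc X Y) := by
  intro z z' hz h
  simp only [setCirc, Set.mem_iUnion] at h ⊢
  obtain ⟨x, hx, y, hy, h⟩ := h
  exact ⟨x, hx, y, hy, GBISpace.circ_mono _ _ _ _ _ _ le_rfl le_rfl hz h⟩

theorem isUpperSet_setLdiv [GBIFrame P] [GBISpace P] (X Y : Set P) :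
    IsUpperSet (setLdiv X Y) := by
  intro z z' hz h w hw
  apply h
  simp only [setCirc, Set.mem_iUnion, Set.mem_singleton_iff] at hw ⊢
  obtain ⟨x, hx, y, rfl, hw⟩ := hw
  exact ⟨x, hx, z, rfl, GBISpace.circ_mono _ _ _ _ _ _ le_rfl hz le_rfl hw⟩

theorem isUpperSet_setRdiv [GBIFrame P] [GBISpace P] (X Y : Set P) :
    IsUpperSet (setRdiv X Y) := by
  intro z z' hz h w hw
  apply h
  simp only [setCirc, Set.mem_iUnion, Set.mem_singleton_iff] at hw ⊢
  obtain ⟨x, rfl, y, hy, hw⟩ := hw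
  exact ⟨z, rfl, y, hy, GBISpace.circ_mono _ _ _ _ _ _ hz le_rfl le_rfl hw⟩

theorem isClopen_setMul [GBIFrame P] [GBISpace P] (U V : ClopenUpperSet P) :
    IsClopen (setMul (U : Set P) V) := by
  have h : setMul (U : Set P) V = setCirc (U : Set P) V := (isUpperSet_setCirc _ _).upperClosure
  rw [h]
  exact GBISpace.isClopen_setCirc _ _ U.isClopen U.upper V.isClopen V.upper

/-- The operations `·`, `\`, `/`, `E` on the clopen upsets of a GBI-space. -/
instance [GBIFrame P] [GBISpace P] : GBIOps (ClopenUpperSet P) where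
  mul U V := ⟨⟨setMul (U : Set P) V, isClopen_setMul U V⟩, (upperClosure _).upper⟩
  one := ⟨⟨E, GBISpace.isClopen_E⟩, GBISpace.isUpperSet_E⟩
  ldiv U V := ⟨⟨setLdiv (U : Set P) V,
    GBISpace.isClopen_setLdiv _ _ U.isClopen U.upper V.isClopen V.upper⟩, isUpperSet_setLdiv _ _⟩
  rdiv U V := ⟨⟨setRdiv (U : Set P) V,
    GBISpace.isClopen_setRdiv _ _ U.isClopen U.upper V.isClopen V.upper⟩, isUpperSet_setRdiv _ _⟩

/-- The preimage `f⁻¹[V]` of a clopen upset under a GBI-p-morphism. -/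
def comap {Q : Type u} [PartialOrder Q] [TopologicalSpace Q] [GBIFrame P] [GBIFrame Q]
    {f : P → Q} (hf : IsGBIPMorphism f) (V : ClopenUpperSet Q) : ClopenUpperSet P :=
  ⟨⟨f ⁻¹' V, V.isClopen.preimage hf.continuous⟩, V.upper.preimage hf.monotone⟩

end ClopenUpperSet

/-! ### The canonical maps -/

/-- `a ↦ ℱ_a`, as a map into the clopen upsets of the space of prime filters. -/
def PrimeFilter.basicClopen {A : Type u} [Lattice A] (a : A) : ClopenUpperSet (PrimeFilter A) :=
  ⟨⟨PrimeFilter.basic a,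
    ⟨⟨TopologicalSpace.isOpen_generateFrom_of_mem (Or.inr ⟨a, rfl⟩)⟩,
      TopologicalSpace.isOpen_generateFrom_of_mem (Or.inl ⟨a, rfl⟩)⟩⟩,
    fun _ _ h ha => h a ha⟩

/-- `x ↦ {U : x ∈ U}`, as a map into the prime filters of the lattice of clopen upsets. -/
def ClopenUpperSet.pointFilter {P : Type u} [PartialOrder P] [TopologicalSpace P] (x : P) :
    PrimeFilter (ClopenUpperSet P) :=
  ⟨Order.IsPFilter.toPFilter (F := {U : ClopenUpperSet P | x ∈ U}) <| Order.IsPFilter.of_def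
      ⟨⊤, Set.mem_univ x⟩
      (fun U hU V hV => ⟨U ⊓ V, ⟨hU, hV⟩, inf_le_left, inf_le_right⟩)
      (fun hUV hU => hUV hU),
    ⟨⟨fun _ _ hVU hU hV => hU (hVU hV), ⟨⊥, fun h => h⟩,
      fun U hU V hV => ⟨U ⊔ V, fun h => h.elim hU hV, le_sup_left, le_sup_right⟩⟩⟩⟩

/-! ### The two functors

Each functor takes as arguments the proofs that it is well defined on objects and on morphisms;
that such proofs exist is part of the theorem. -/

/-- The functor `F_p`: `A ↦ (F_p(A), ⊆, ∘, ℱ_1, τ)` and `h ↦ h⁻¹[·]`. -/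
def primeFilterFunctor (hobj : ∀ A : GBIAlg.{u}, GBISpace (PrimeFilter A))
    (hmap : ∀ (A B : GBIAlg.{u}) (h : A ⟶ B), IsGBIPMorphism (PrimeFilter.comap h.isHom)) :
    GBIAlg.{u} ⥤ GBISp.{u}ᵒᵖ where
  obj A := op (@GBISp.mk (PrimeFilter A) _ _ _ (hobj A))
  map {A B} h := Quiver.Hom.op ⟨PrimeFilter.comap h.isHom, hmap A B h⟩
  map_id _ := rfl
  map_comp _ _ := rfl

/-- The functor `U_c`: `P ↦ (U_c(P), ∩, ∪, →, ∅, P, ·, \, /, E)` and `f ↦ f⁻¹[·]`. -/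
def clopenUpsetFunctor (hobj : ∀ P : GBISp.{u}, GBIAlgebra (ClopenUpperSet P))
    (hmap : ∀ (P Q : GBISp.{u}) (f : P ⟶ Q), IsGBIHom (ClopenUpperSet.comap f.isPMorphism)) :
    GBISp.{u}ᵒᵖ ⥤ GBIAlg.{u} where
  obj P := @GBIAlg.mk (ClopenUpperSet P.unop) _ _ (hobj P.unop)
  map {P Q} f := ⟨ClopenUpperSet.comap f.unop.isPMorphism, hmap Q.unop P.unop f.unop⟩
  map_id _ := rfl
  map_comp _ _ := rfl

/-! ### Monotonicity and distributivity of the product of a GBI-algebra -/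

/-! The Heyting part is Esakia duality. Distinct elements are separated by prime filters, and by
compactness every clopen upset of prime filters is some `basic a` (`exists_eq_basic`). Conversely,
compactness makes every prime filter of clopen upsets the filter of a point
(`pointFilter_surjective`).

The product is encoded by the ternary relation `H ∈ circ F G`, and what carries it is the extension
lemma `exists_mem_circ`: if the products of two filters avoid an ideal, the filters extend to prime
filters whose products lie in a prime filter that still avoids the ideal. Residuation enters by
making the product preserve finite joins in each argument, which turns the obstructions to extending
a filter into ideals. The lemma yields `setCirc_basic`, `setLdiv_basic` and `setRdiv_basic`, so that
the axioms about clopen upsets become identities of the algebra. It also yields the back conditions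
for preimage maps, where preservation of each residual supplies the required disjointness.

On the space side the algebra laws are read off pointwise, each clause of a p-morphism giving
preservation of one operation. The separation axiom for `∘` is what lets the clopen upsets recover
the relation (`pointFilter_mem_circ_iff`). -/

namespace GBIAlgebra

variable {A : Type u} [HeytingAlgebra A] [GBIOps A] [GBIAlgebra A]

theorem mul_le_mul_left_of_le {a a' : A} (b : A) (h : a ≤ a') : a * b ≤ a' * b :=
  (mul_le_iff_le_rdiv _ _ _).2 (h.trans ((mul_le_iff_le_rdiv _ _ _).1 le_rfl))

theorem mul_le_mul_right_of_le (a : A) {b b' : A} (h : b ≤ b') : a * b ≤ a * b' :=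
  (mul_le_iff_le_ldiv _ _ _).2 (h.trans ((mul_le_iff_le_ldiv _ _ _).1 le_rfl))

theorem mul_mono {a a' b b' : A} (ha : a ≤ a') (hb : b ≤ b') : a * b ≤ a' * b' :=
  (mul_le_mul_left_of_le b ha).trans (mul_le_mul_right_of_le a' hb)

/-- Multiplication by a fixed element has a residual as right adjoint, so it preserves joins. The
same reason gives `mul_sup`, `bot_mul` and `mul_bot`. -/
theorem sup_mul (a b c : A) : (a ⊔ b) * c = a * c ⊔ b * c := by
  refine le_antisymm ?_ (sup_le (mul_le_mul_left_of_le c le_sup_left)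
    (mul_le_mul_left_of_le c le_sup_right))
  rw [mul_le_iff_le_rdiv]
  exact sup_le ((mul_le_iff_le_rdiv _ _ _).1 le_sup_left)
    ((mul_le_iff_le_rdiv _ _ _).1 le_sup_right)

theorem mul_sup (a b c : A) : a * (b ⊔ c) = a * b ⊔ a * c := by
  refine le_antisymm ?_ (sup_le (mul_le_mul_right_of_le a le_sup_left)
    (mul_le_mul_right_of_le a le_sup_right))
  rw [mul_le_iff_le_ldiv]
  exact sup_le ((mul_le_iff_le_ldiv _ _ _).1 le_sup_left)
    ((mul_le_iff_le_ldiv _ _ _).1 le_sup_right)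

theorem bot_mul (a : A) : ⊥ * a = ⊥ :=
  le_bot_iff.1 ((mul_le_iff_le_rdiv _ _ _).2 bot_le)

theorem mul_bot (a : A) : a * ⊥ = ⊥ :=
  le_bot_iff.1 ((mul_le_iff_le_ldiv _ _ _).2 bot_le)

theorem mul_ldiv_le (a b : A) : a * GBIOps.ldiv a b ≤ b :=
  (mul_le_iff_le_ldiv _ _ _).2 le_rfl

theorem rdiv_mul_le (a b : A) : GBIOps.rdiv b a * a ≤ b :=
  (mul_le_iff_le_rdiv _ _ _).2 le_rfl

end GBIAlgebra

/-! ### Filters and ideals of bounded lattices -/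

namespace Order

variable {A B : Type u}

/-- A filter of a lattice with a top element, from closure under `⊤`, `⊓` and `≤`. -/
def PFilter.ofInf [Lattice A] [OrderTop A] (s : Set A) (htop : ⊤ ∈ s)
    (hinf : ∀ a ∈ s, ∀ b ∈ s, a ⊓ b ∈ s) (hle : ∀ a ∈ s, ∀ b, a ≤ b → b ∈ s) : PFilter A :=
  IsPFilter.toPFilter (F := s) <| IsPFilter.of_def ⟨⊤, htop⟩
    (fun a ha b hb => ⟨a ⊓ b, hinf a ha b hb, inf_le_left, inf_le_right⟩)
    (fun hab ha => hle _ ha _ hab)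

/-- An ideal of a lattice with a bottom element, from closure under `⊥`, `⊔` and `≥`. -/
def Ideal.ofSup [Lattice A] [OrderBot A] (s : Set A) (hbot : ⊥ ∈ s)
    (hsup : ∀ a ∈ s, ∀ b ∈ s, a ⊔ b ∈ s) (hle : ∀ a ∈ s, ∀ b, b ≤ a → b ∈ s) : Ideal A :=
  ⟨⟨s, fun _ _ hab ha => hle _ ha _ hab⟩, ⟨⊥, hbot⟩,
    fun a ha b hb => ⟨a ⊔ b, hsup a ha b hb, le_sup_left, le_sup_right⟩⟩

/-- The filter generated by two filters of a lattice. -/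
def PFilter.join [Lattice A] [OrderTop A] (X Y : PFilter A) : PFilter A :=
  PFilter.ofInf {c | ∃ a ∈ X, ∃ b ∈ Y, a ⊓ b ≤ c}
    ⟨⊤, PFilter.top_mem, ⊤, PFilter.top_mem, le_top⟩
    (by
      rintro c ⟨a, ha, b, hb, h⟩ c' ⟨a', ha', b', hb', h'⟩
      refine ⟨a ⊓ a', PFilter.inf_mem ha ha', b ⊓ b', PFilter.inf_mem hb hb', ?_⟩
      rw [inf_inf_inf_comm]
      exact inf_le_inf h h')
    (by
      rintro c ⟨a, ha, b, hb, h⟩ c' hc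
      exact ⟨a, ha, b, hb, h.trans hc⟩)

theorem PFilter.mem_join [Lattice A] [OrderTop A] {X Y : PFilter A} {c : A} :
    c ∈ X.join Y ↔ ∃ a ∈ X, ∃ b ∈ Y, a ⊓ b ≤ c := Iff.rfl

/-- The filter generated by the products of elements of two filters of a GBI-algebra. -/
def PFilter.mul [HeytingAlgebra A] [GBIOps A] [GBIAlgebra A] (X Y : PFilter A) : PFilter A :=
  PFilter.ofInf {c | ∃ a ∈ X, ∃ b ∈ Y, a * b ≤ c}
    ⟨⊤, PFilter.top_mem, ⊤, PFilter.top_mem, le_top⟩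
    (by
      rintro c ⟨a, ha, b, hb, h⟩ c' ⟨a', ha', b', hb', h'⟩
      exact ⟨a ⊓ a', PFilter.inf_mem ha ha', b ⊓ b', PFilter.inf_mem hb hb',
        le_inf ((GBIAlgebra.mul_mono inf_le_left inf_le_left).trans h)
          ((GBIAlgebra.mul_mono inf_le_right inf_le_right).trans h')⟩)
    (by
      rintro c ⟨a, ha, b, hb, h⟩ c' hc
      exact ⟨a, ha, b, hb, h.trans hc⟩)

theorem PFilter.mem_mul [HeytingAlgebra A] [GBIOps A] [GBIAlgebra A] {X Y : PFilter A} {c : A} :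
    c ∈ X.mul Y ↔ ∃ a ∈ X, ∃ b ∈ Y, a * b ≤ c := Iff.rfl

variable [HeytingAlgebra A] [GBIOps A] [HeytingAlgebra B] [GBIOps B] {h : A → B}

/-- The filter generated by the image of a filter under a GBI-homomorphism. -/
def PFilter.map (hh : IsGBIHom h) (X : PFilter A) : PFilter B :=
  PFilter.ofInf {b | ∃ a ∈ X, h a ≤ b} ⟨⊤, PFilter.top_mem, le_top⟩
    (by
      rintro b ⟨a, ha, hab⟩ b' ⟨a', ha', hab'⟩
      refine ⟨a ⊓ a', PFilter.inf_mem ha ha', ?_⟩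
      rw [hh.map_inf]
      exact inf_le_inf hab hab')
    (by
      rintro b ⟨a, ha, hab⟩ b' hb
      exact ⟨a, ha, hab.trans hb⟩)

theorem PFilter.mem_map {hh : IsGBIHom h} {X : PFilter A} {b : B} :
    b ∈ X.map hh ↔ ∃ a ∈ X, h a ≤ b := Iff.rfl

/-- The ideal generated by the image of an ideal under a GBI-homomorphism. -/
def Ideal.map (hh : IsGBIHom h) (I : Ideal A) : Ideal B :=
  Ideal.ofSup {b | ∃ a ∈ I, b ≤ h a} ⟨⊥, Ideal.bot_mem I, bot_le⟩
    (by
      rintro b ⟨a, ha, hab⟩ b' ⟨a', ha', hab'⟩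
      refine ⟨a ⊔ a', Ideal.sup_mem ha ha', ?_⟩
      rw [hh.map_sup]
      exact sup_le_sup hab hab')
    (by
      rintro b ⟨a, ha, hab⟩ b' hb
      exact ⟨a, ha, hb.trans hab⟩)

theorem Ideal.mem_map {hh : IsGBIHom h} {I : Ideal A} {b : B} :
    b ∈ I.map hh ↔ ∃ a ∈ I, b ≤ h a := Iff.rfl

end Order

/-! ### Prime filters of a Heyting algebra -/

namespace PrimeFilter

open Order

variable {A : Type u} [HeytingAlgebra A]

theorem mem_of_le {F : PrimeFilter A} {a b : A} (h : a ≤ b) (ha : a ∈ F) : b ∈ F :=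
  PFilter.mem_of_le (F := F.1) h ha

theorem top_mem (F : PrimeFilter A) : ⊤ ∈ F := PFilter.top_mem (F := F.1)

theorem inf_mem_iff {F : PrimeFilter A} {a b : A} : a ⊓ b ∈ F ↔ a ∈ F ∧ b ∈ F :=
  PFilter.inf_mem_iff (F := F.1)

theorem bot_notMem (F : PrimeFilter A) : ⊥ ∉ F := by
  obtain ⟨b, hb⟩ := F.2.compl_ideal.Nonempty
  exact fun h => hb (mem_of_le bot_le h)

theorem sup_mem_iff {F : PrimeFilter A} {a b : A} : a ⊔ b ∈ F ↔ a ∈ F ∨ b ∈ F := by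
  refine ⟨fun h => ?_, fun h => h.elim (mem_of_le le_sup_left) (mem_of_le le_sup_right)⟩
  by_contra! hab
  obtain ⟨c, hc, hac, hbc⟩ := F.2.compl_ideal.Directed a hab.1 b hab.2
  exact hc (mem_of_le (sup_le hac hbc) h)

/-- The complement of a prime filter, as an ideal. -/
def complIdeal (F : PrimeFilter A) : Ideal A := F.2.compl_ideal.toIdeal

/-- The prime filter theorem. -/
theorem exists_of_disjoint (X : PFilter A) (I : Ideal A) (h : ∀ a ∈ X, a ∉ I) :
    ∃ F : PrimeFilter A, (∀ a ∈ X, a ∈ F) ∧ ∀ a ∈ I, a ∉ F := by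
  obtain ⟨J, hJ, hIJ, hXJ⟩ :=
    DistribLattice.prime_ideal_of_disjoint_filter_ideal (Set.disjoint_left.2 h)
  refine ⟨⟨hJ.toPrimePair.F, hJ.toPrimePair.F_isPrime⟩, fun a ha haJ => ?_, fun a ha haF => ?_⟩
  · exact Set.disjoint_left.1 hXJ ha haJ
  · exact haF (hIJ ha)

theorem exists_mem_notMem {a b : A} (h : ¬a ≤ b) : ∃ F : PrimeFilter A, a ∈ F ∧ b ∉ F := by
  obtain ⟨F, hF, hF'⟩ := exists_of_disjoint (PFilter.principal a) (Ideal.principal b)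
    (fun c hc hc' => h (le_trans (PFilter.mem_principal.1 hc) (Ideal.mem_principal.1 hc')))
  exact ⟨F, hF a (PFilter.mem_principal.2 le_rfl), hF' b (Ideal.mem_principal.2 le_rfl)⟩

/-! ### Extension of pairs of filters to related prime filters -/

variable [GBIOps A]

theorem mem_circ {F G H : PrimeFilter A} :
    H ∈ GBIFrame.circ F G ↔ ∀ a ∈ F, ∀ b ∈ G, a * b ∈ H := by
  change H ∈ (⋂ a ∈ F, ⋂ b ∈ G, basic (a * b)) ↔ _
  simp only [Set.mem_iInter]
  rfl

theorem circ_mono {F F' G G' H H' : PrimeFilter A} (hF : F' ≤ F) (hG : G' ≤ G) (hH : H ≤ H')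
    (h : H ∈ GBIFrame.circ F G) : H' ∈ GBIFrame.circ F' G' :=
  mem_circ.2 fun a ha b hb => hH _ (mem_circ.1 h a (hF a ha) b (hG b hb))

variable [GBIAlgebra A]

/-- Two filters whose product avoids an ideal extend to prime filters with the same property,
and their product to a prime filter. -/
theorem exists_mem_circ (X Y : PFilter A) (I : Ideal A) (h : ∀ a ∈ X, ∀ b ∈ Y, a * b ∉ I) :
    ∃ F G H : PrimeFilter A, (∀ a ∈ X, a ∈ F) ∧ (∀ b ∈ Y, b ∈ G) ∧ H ∈ GBIFrame.circ F G ∧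
      ∀ c ∈ I, c ∉ H := by
  -- The product filter is made prime first. With `H` fixed, `X` and then `Y` are enlarged while all
  -- products stay in `H`. The filters need not be assumed proper: products with `⊥` are `⊥`, which
  -- lies in every ideal.
  obtain ⟨H, hH, hHI⟩ := exists_of_disjoint (X.mul Y) I (by
    rintro c ⟨a, ha, b, hb, hc⟩ hcI
    exact h a ha b hb (I.lower hc hcI))
  replace hH : ∀ a ∈ X, ∀ b ∈ Y, a * b ∈ H := fun a ha b hb => hH _ ⟨a, ha, b, hb, le_rfl⟩
  -- The elements that `F` must not contain form an ideal: closure under joins combines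
  -- distributivity of the product with primality of `H`.
  obtain ⟨F, hXF, hF⟩ := exists_of_disjoint X (Ideal.ofSup {a | ∃ b ∈ Y, a * b ∉ H}
    ⟨⊤, PFilter.top_mem, by rw [GBIAlgebra.bot_mul]; exact bot_notMem H⟩
    (by
      rintro a ⟨b, hb, hab⟩ a' ⟨b', hb', hab'⟩
      refine ⟨b ⊓ b', PFilter.inf_mem hb hb', ?_⟩
      rw [GBIAlgebra.sup_mul, sup_mem_iff, not_or]
      exact ⟨fun h => hab (mem_of_le (GBIAlgebra.mul_le_mul_right_of_le _ inf_le_left) h),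
        fun h => hab' (mem_of_le (GBIAlgebra.mul_le_mul_right_of_le _ inf_le_right) h)⟩)
    (by
      rintro a ⟨b, hb, hab⟩ a' ha
      exact ⟨b, hb, fun h => hab (mem_of_le (GBIAlgebra.mul_le_mul_left_of_le _ ha) h)⟩))
    (by
      rintro a ha ⟨b, hb, hab⟩
      exact hab (hH a ha b hb))
  replace hF : ∀ a ∈ F, ∀ b ∈ Y, a * b ∈ H := fun a ha b hb => by
    by_contra hab
    exact hF a ⟨b, hb, hab⟩ ha
  -- The bad set is now formed with the prime filter `F` in place of `X`, so that the products
  -- controlled at the end are those of `F` and `G`.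
  obtain ⟨G, hYG, hG⟩ := exists_of_disjoint Y (Ideal.ofSup {b | ∃ a ∈ F, a * b ∉ H}
    ⟨⊤, top_mem F, by rw [GBIAlgebra.mul_bot]; exact bot_notMem H⟩
    (by
      rintro b ⟨a, ha, hab⟩ b' ⟨a', ha', hab'⟩
      refine ⟨a ⊓ a', inf_mem_iff.2 ⟨ha, ha'⟩, ?_⟩
      rw [GBIAlgebra.mul_sup, sup_mem_iff, not_or]
      exact ⟨fun h => hab (mem_of_le (GBIAlgebra.mul_le_mul_left_of_le _ inf_le_left) h),
        fun h => hab' (mem_of_le (GBIAlgebra.mul_le_mul_left_of_le _ inf_le_right) h)⟩)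
    (by
      rintro b ⟨a, ha, hab⟩ b' hb
      exact ⟨a, ha, fun h => hab (mem_of_le (GBIAlgebra.mul_le_mul_right_of_le _ hb) h)⟩))
    (by
      rintro b hb ⟨a, ha, hab⟩
      exact hab (hF a ha b hb))
  refine ⟨F, G, H, hXF, hYG, mem_circ.2 fun a ha b hb => ?_, hHI⟩
  by_contra hab
  exact hG b ⟨a, ha, hab⟩ hb

/-- Avoiding the complement of `H` produces a prime filter contained in `H`; since `circ F G` is an
upset, `H` itself belongs to it. -/
theorem exists_mem_circ_le (X Y : PFilter A) (H : PrimeFilter A)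
    (h : ∀ a ∈ X, ∀ b ∈ Y, a * b ∈ H) :
    ∃ F G : PrimeFilter A, (∀ a ∈ X, a ∈ F) ∧ (∀ b ∈ Y, b ∈ G) ∧ H ∈ GBIFrame.circ F G := by
  obtain ⟨F, G, H', hF, hG, hH', hH⟩ := exists_mem_circ X Y H.complIdeal
    fun a ha b hb hab => hab (h a ha b hb)
  refine ⟨F, G, hF, hG, circ_mono le_rfl le_rfl (fun c hc => ?_) hH'⟩
  by_contra hc'
  exact hH c hc' hc

end PrimeFilter

/-! ### Elementwise descriptions of the operations on subsets -/

namespace GBIFrame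

variable {P : Type u} [GBIFrame P] {X Y : Set P} {z : P}

theorem mem_setCirc : z ∈ setCirc X Y ↔ ∃ x ∈ X, ∃ y ∈ Y, z ∈ circ x y := by
  simp only [setCirc, Set.mem_iUnion, exists_prop]

theorem mem_setLdiv : z ∈ setLdiv X Y ↔ ∀ x ∈ X, ∀ w ∈ circ x z, w ∈ Y := by
  refine ⟨fun h x hx w hw => h (mem_setCirc.2 ⟨x, hx, z, rfl, hw⟩), fun h w hw => ?_⟩
  obtain ⟨x, hx, _, rfl, hxw⟩ := mem_setCirc.1 hw
  exact h x hx w hxw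

theorem mem_setRdiv : z ∈ setRdiv X Y ↔ ∀ y ∈ Y, ∀ w ∈ circ z y, w ∈ X := by
  refine ⟨fun h y hy w hw => h (mem_setCirc.2 ⟨z, rfl, y, hy, hw⟩), fun h w hw => ?_⟩
  obtain ⟨_, rfl, y, hy, hyw⟩ := mem_setCirc.1 hw
  exact h y hy w hyw

end GBIFrame

/-! ### The Esakia space of prime filters of a Heyting algebra -/

namespace PrimeFilter

open Order

section Topology

variable {A : Type u} [HeytingAlgebra A]

theorem isClopen_basic (a : A) : IsClopen (basic a) := (basicClopen a).isClopen

theorem basic_inf (a b : A) : basic (a ⊓ b) = basic a ∩ basic b := by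
  ext F
  exact inf_mem_iff

theorem basic_sup (a b : A) : basic (a ⊔ b) = basic a ∪ basic b := by
  ext F
  exact sup_mem_iff

theorem basic_bot : basic (⊥ : A) = ∅ :=
  Set.eq_empty_of_forall_notMem fun F => bot_notMem F

theorem basic_mono {a b : A} (h : a ≤ b) : basic a ⊆ basic b := fun _ ha => mem_of_le h ha

theorem basic_subset_iff {a b : A} : basic a ⊆ basic b ↔ a ≤ b := by
  refine ⟨fun h => ?_, basic_mono⟩
  by_contra hab
  obtain ⟨F, ha, hb⟩ := exists_mem_notMem hab
  exact hb (h ha)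

/-- For an ultrafilter `l` on the prime filters, `{a : ℱ_a ∈ l}` is a prime filter. -/
theorem exists_mem_iff_basic_mem (l : Ultrafilter (PrimeFilter A)) :
    ∃ F : PrimeFilter A, ∀ a, a ∈ F ↔ basic a ∈ l := by
  let X : PFilter A := PFilter.ofInf {a | basic a ∈ l}
    (Filter.mem_of_superset Filter.univ_mem fun F _ => top_mem F)
    (fun a ha b hb => by
      change basic (a ⊓ b) ∈ l
      rw [basic_inf]
      exact Filter.inter_mem ha hb)
    (fun a ha b hab => Filter.mem_of_superset ha (basic_mono hab))
  let I : Ideal A := Ideal.ofSup {a | basic a ∉ l}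
    (by
      change basic (⊥ : A) ∉ l
      rw [basic_bot]
      exact l.empty_notMem)
    (fun a ha b hb => by
      change basic (a ⊔ b) ∉ l
      rw [basic_sup, Ultrafilter.union_mem_iff, not_or]
      exact ⟨ha, hb⟩)
    (fun a ha b hab hb => ha (Filter.mem_of_superset hb (basic_mono hab)))
  obtain ⟨F, hX, hI⟩ := exists_of_disjoint X I (fun a ha ha' => ha' ha)
  exact ⟨F, fun a => ⟨fun ha => by_contra fun h => hI a h ha, hX a⟩⟩

instance : CompactSpace (PrimeFilter A) := by
  refine ⟨isCompact_iff_ultrafilter_le_nhds.2 fun l _ => ?_⟩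
  obtain ⟨F, hF⟩ := exists_mem_iff_basic_mem l
  refine ⟨F, Set.mem_univ F, ?_⟩
  rw [TopologicalSpace.nhds_generateFrom]
  simp only [le_iInf_iff, Filter.le_principal_iff]
  -- Convergence need only be tested on the subbasis, where it is the defining property of `F`;
  -- complements are handled by maximality of the ultrafilter.
  rintro s ⟨hFs, ⟨a, rfl⟩ | ⟨a, rfl⟩⟩
  · exact (hF a).1 hFs
  · exact Ultrafilter.compl_mem_iff_notMem.2 fun h => hFs ((hF a).2 h)

theorem exists_mem_notMem_of_not_le {F G : PrimeFilter A} (h : ¬F ≤ G) : ∃ a ∈ F, a ∉ G := by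
  by_contra! h'
  exact h h'

instance : PriestleySpace (PrimeFilter A) where
  priestley {F G} h := by
    obtain ⟨a, ha, hb⟩ := exists_mem_notMem_of_not_le h
    exact ⟨basic a, isClopen_basic a, (basicClopen a).upper, ha, hb⟩

/-- Meets and joins turn a finite intersection of subbasic sets into a single difference. By
compactness every clopen set is then a finite union of such differences, which reduces its downset
to `basic_himp`. -/
theorem isTopologicalBasis_basic_sdiff : TopologicalSpace.IsTopologicalBasis
    (Set.range fun p : A × A => basic p.1 \ basic p.2) := by
  refine ⟨?_, ?_, ?_⟩
  · rintro _ ⟨⟨a, b⟩, rfl⟩ _ ⟨⟨a', b'⟩, rfl⟩ F hF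
    refine ⟨_, ⟨(a ⊓ a', b ⊔ b'), rfl⟩, ?_, ?_⟩
    · simp only [basic_inf, basic_sup, Set.mem_sdiff, Set.mem_inter_iff, Set.mem_union] at hF ⊢
      tauto
    · intro G hG
      simp only [basic_inf, basic_sup, Set.mem_sdiff, Set.mem_inter_iff, Set.mem_union] at hG ⊢
      tauto
  · refine Set.eq_univ_of_forall fun F => ⟨_, ⟨(⊤, ⊥), rfl⟩, top_mem F, bot_notMem F⟩
  · refine le_antisymm (le_generateFrom ?_) (le_generateFrom ?_)
    · rintro _ ⟨⟨a, b⟩, rfl⟩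
      exact ((isClopen_basic a).diff (isClopen_basic b)).isOpen
    · rintro _ (⟨a, rfl⟩ | ⟨a, rfl⟩)
      · refine TopologicalSpace.isOpen_generateFrom_of_mem ⟨(a, ⊥), ?_⟩
        simp only [basic_bot, Set.sdiff_empty]
      · refine TopologicalSpace.isOpen_generateFrom_of_mem ⟨(⊤, a), ?_⟩
        ext F
        exact ⟨fun h => h.2, fun h => ⟨top_mem F, h⟩⟩

/-- `ℱ_{a → b} = P - ↓(ℱ_a - ℱ_b)`. -/
theorem basic_himp (a b : A) :
    basic (a ⇨ b) = ((lowerClosure (basic a \ basic b) : LowerSet (PrimeFilter A)) : Set _)ᶜ := by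
  ext F
  simp only [Set.mem_compl_iff, SetLike.mem_coe, mem_lowerClosure]
  constructor
  · rintro h ⟨G, ⟨ha, hb⟩, hFG⟩
    have hG : (a ⇨ b) ⊓ a ∈ G := inf_mem_iff.2 ⟨hFG _ h, ha⟩
    exact hb (mem_of_le himp_inf_le hG)
  · intro h
    by_contra hF
    -- The filter generated by `F` and `a` misses `b`: from `f ⊓ a ≤ b` with `f ∈ F` it would follow
    -- that `f ≤ a ⇨ b`.
    obtain ⟨G, hG, hbG⟩ := exists_of_disjoint (PFilter.join F.1 (PFilter.principal a))
      (Ideal.principal b) (by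
        rintro c ⟨f, hf, d, hd, hc⟩ hcb
        refine hF (mem_of_le (le_himp_iff.2 ?_) hf)
        exact (inf_le_inf_left f (PFilter.mem_principal.1 hd)).trans
          (hc.trans (Ideal.mem_principal.1 hcb)))
    refine h ⟨G, ⟨hG a ?_, hbG b (Ideal.mem_principal.2 le_rfl)⟩, fun c hc => hG c ?_⟩
    · exact PFilter.mem_join.2 ⟨⊤, PFilter.top_mem, a, PFilter.mem_principal.2 le_rfl, inf_le_right⟩
    · exact PFilter.mem_join.2 ⟨c, hc, a, PFilter.mem_principal.2 le_rfl, inf_le_left⟩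

instance : EsakiaSpace (PrimeFilter A) where
  isTopologicalBasis_isClopen := _root_.isTopologicalBasis_isClopen
  isClopen_lowerClosure U hU := by
    obtain ⟨s, hs, rfl⟩ := (isCompact_open_iff_eq_finite_iUnion_of_isTopologicalBasis _
      isTopologicalBasis_basic_sdiff
      (fun p => ((isClopen_basic p.1).diff (isClopen_basic p.2)).isClosed.isCompact) U).1
      ⟨hU.isClosed.isCompact, hU.isOpen⟩
    simp only [lowerClosure_iUnion, LowerSet.coe_iSup]
    refine hs.isClopen_biUnion fun p _ => ?_
    rw [← isClopen_compl_iff, ← basic_himp]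
    exact isClopen_basic _

/-- The clopen upsets of the space of prime filters are the sets `ℱ_a`. -/
theorem exists_eq_basic {U : Set (PrimeFilter A)} (hU : IsClopen U) (hU' : IsUpperSet U) :
    ∃ a, U = basic a := by
  have key : ∀ F ∈ U, ∃ a ∈ F, basic a ⊆ U := by
    intro F hF
    have : Nonempty {a // a ∈ F} := ⟨⟨⊤, top_mem F⟩⟩
    -- The sets `basic a` with `a ∈ F` form a directed family of compact sets whose intersection is
    -- the principal upset of `F`, hence inside `U`; one member already lies in `U`.
    obtain ⟨⟨a, ha⟩, haU⟩ := exists_subset_nhds_of_isCompact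
      (V := fun a : {a // a ∈ F} => basic a.1) (U := U)
      (fun a b => ⟨⟨a.1 ⊓ b.1, inf_mem_iff.2 ⟨a.2, b.2⟩⟩, basic_mono inf_le_left,
        basic_mono inf_le_right⟩)
      (fun a => (isClopen_basic a.1).isClosed.isCompact)
      (fun G hG => hU.isOpen.mem_nhds (hU' (fun a ha => Set.mem_iInter.1 hG ⟨a, ha⟩) hF))
    exact ⟨a, ha, haU⟩
  have : Nonempty {a // basic a ⊆ U} := ⟨⟨⊥, by rw [basic_bot]; exact Set.empty_subset U⟩⟩
  -- Binary joins make this cover of `U` directed, so that compactness leaves a single basic set.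
  obtain ⟨⟨a, ha⟩, haU⟩ := hU.isClosed.isCompact.elim_directed_cover
    (fun a : {a // basic a ⊆ U} => basic a.1) (fun a => (isClopen_basic a.1).isOpen)
    (fun F hF => by
      obtain ⟨a, ha, haU⟩ := key F hF
      exact Set.mem_iUnion.2 ⟨⟨a, haU⟩, ha⟩)
    (fun a b => ⟨⟨a.1 ⊔ b.1, by rw [basic_sup]; exact Set.union_subset a.2 b.2⟩,
        basic_mono le_sup_left, basic_mono le_sup_right⟩)
  exact ⟨a, haU.antisymm ha⟩

end Topology

/-! ### The GBI-space of prime filters of a GBI-algebra -/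

section GBI

open GBIFrame

variable {A : Type u} [HeytingAlgebra A] [GBIOps A] [GBIAlgebra A]

theorem setCirc_basic (a b : A) : setCirc (basic a) (basic b) = basic (a * b) := by
  ext H
  rw [mem_setCirc]
  constructor
  · rintro ⟨F, hF, G, hG, h⟩
    exact mem_circ.1 h a hF b hG
  · intro h
    obtain ⟨F, G, hF, hG, h⟩ := exists_mem_circ_le (PFilter.principal a) (PFilter.principal b) H
      fun c hc d hd => mem_of_le (GBIAlgebra.mul_mono (PFilter.mem_principal.1 hc)
        (PFilter.mem_principal.1 hd)) h
    exact ⟨F, hF a (PFilter.mem_principal.2 le_rfl), G, hG b (PFilter.mem_principal.2 le_rfl), h⟩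

/-- If `a \ b ∉ G`, residuation says that no product of `a` with an element of `G` is below `b`.
Extension then gives a counterexample over some `G' ≥ G`, and antitonicity of `circ` brings it back
to `G`. -/
theorem setLdiv_basic (a b : A) : setLdiv (basic a) (basic b) = basic (GBIOps.ldiv a b) := by
  ext G
  rw [mem_setLdiv]
  constructor
  · intro h
    by_contra hG
    obtain ⟨F, G', H, hF, hG', hH, hbH⟩ := exists_mem_circ (PFilter.principal a) G.1
      (Ideal.principal b) fun c hc d hd hcd => hG (mem_of_le
        ((GBIAlgebra.mul_le_iff_le_ldiv _ _ _).1 ((GBIAlgebra.mul_le_mul_left_of_le d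
          (PFilter.mem_principal.1 hc)).trans (Ideal.mem_principal.1 hcd))) hd)
    exact hbH b (Ideal.mem_principal.2 le_rfl)
      (h F (hF a (PFilter.mem_principal.2 le_rfl)) H (circ_mono le_rfl hG' le_rfl hH))
  · intro h F hF H hH
    exact mem_of_le (GBIAlgebra.mul_ldiv_le a b) (mem_circ.1 hH a hF _ h)

theorem setRdiv_basic (a b : A) : setRdiv (basic a) (basic b) = basic (GBIOps.rdiv a b) := by
  ext F
  rw [mem_setRdiv]
  constructor
  · intro h
    by_contra hF
    obtain ⟨F', G, H, hF', hG, hH, haH⟩ := exists_mem_circ F.1 (PFilter.principal b)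
      (Ideal.principal a) fun c hc d hd hcd => hF (mem_of_le
        ((GBIAlgebra.mul_le_iff_le_rdiv _ _ _).1 ((GBIAlgebra.mul_le_mul_right_of_le c
          (PFilter.mem_principal.1 hd)).trans (Ideal.mem_principal.1 hcd))) hc)
    exact haH a (Ideal.mem_principal.2 le_rfl)
      (h G (hG b (PFilter.mem_principal.2 le_rfl)) H (circ_mono hF' le_rfl le_rfl hH))
  · intro h G hG H hH
    exact mem_of_le (GBIAlgebra.rdiv_mul_le b a) (mem_circ.1 hH _ h b hG)

/-- Associativity of `∘` reduces to associativity of triple products. The intermediate prime filter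
comes from extending the filter generated by the products of `F` and `G`; the enlargement of `H` is
undone by monotonicity. -/
theorem mem_setCirc_circ_left {F G H K : PrimeFilter A} :
    K ∈ setCirc (circ F G) {H} ↔ ∀ a ∈ F, ∀ b ∈ G, ∀ c ∈ H, a * b * c ∈ K := by
  rw [mem_setCirc]
  constructor
  · rintro ⟨L, hL, _, rfl, hK⟩ a ha b hb c hc
    exact mem_circ.1 hK _ (mem_circ.1 hL a ha b hb) c hc
  · intro h
    obtain ⟨L, H', hL, hH', hK⟩ := exists_mem_circ_le (PFilter.mul F.1 G.1) H.1 K (by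
      rintro d ⟨a, ha, b, hb, hd⟩ c hc
      exact mem_of_le (GBIAlgebra.mul_le_mul_left_of_le c hd) (h a ha b hb c hc))
    exact ⟨L, mem_circ.2 fun a ha b hb => hL _ (PFilter.mem_mul.2 ⟨a, ha, b, hb, le_rfl⟩), H, rfl,
      circ_mono le_rfl hH' le_rfl hK⟩

theorem mem_setCirc_circ_right {F G H K : PrimeFilter A} :
    K ∈ setCirc {F} (circ G H) ↔ ∀ a ∈ F, ∀ b ∈ G, ∀ c ∈ H, a * (b * c) ∈ K := by
  rw [mem_setCirc]
  constructor
  · rintro ⟨_, rfl, L, hL, hK⟩ a ha b hb c hc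
    exact mem_circ.1 hK a ha _ (mem_circ.1 hL b hb c hc)
  · intro h
    obtain ⟨F', L, hF', hL, hK⟩ := exists_mem_circ_le F.1 (PFilter.mul G.1 H.1) K (by
      rintro a ha d ⟨b, hb, c, hc, hd⟩
      exact mem_of_le (GBIAlgebra.mul_le_mul_right_of_le a hd) (h a ha b hb c hc))
    exact ⟨F, rfl, L, mem_circ.2 fun b hb c hc => hL _ (PFilter.mem_mul.2 ⟨b, hb, c, hc, le_rfl⟩),
      circ_mono hF' le_rfl le_rfl hK⟩

/-- Clopen upsets being basic sets, the unit laws and the clopenness of the operations are read off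
the algebra. -/
instance : GBISpace (PrimeFilter A) where
  circ_assoc F G H := by
    ext K
    simp only [mem_setCirc_circ_left, mem_setCirc_circ_right, GBIAlgebra.mul_assoc]
  isClopen_E := isClopen_basic 1
  isUpperSet_E := (basicClopen (1 : A)).upper
  E_circ U hU hU' := by
    obtain ⟨a, rfl⟩ := exists_eq_basic hU hU'
    exact (setCirc_basic 1 a).trans (congrArg basic (GBIAlgebra.one_mul a))
  circ_E U hU hU' := by
    obtain ⟨a, rfl⟩ := exists_eq_basic hU hU'
    exact (setCirc_basic a 1).trans (congrArg basic (GBIAlgebra.mul_one a))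
  circ_mono _ _ _ _ _ _ hF hG hH h := circ_mono hF hG hH h
  isClopen_setCirc U V hU hU' hV hV' := by
    obtain ⟨a, rfl⟩ := exists_eq_basic hU hU'
    obtain ⟨b, rfl⟩ := exists_eq_basic hV hV'
    rw [setCirc_basic]
    exact isClopen_basic _
  isClopen_setLdiv U V hU hU' hV hV' := by
    obtain ⟨a, rfl⟩ := exists_eq_basic hU hU'
    obtain ⟨b, rfl⟩ := exists_eq_basic hV hV'
    rw [setLdiv_basic]
    exact isClopen_basic _
  isClopen_setRdiv U V hU hU' hV hV' := by
    obtain ⟨a, rfl⟩ := exists_eq_basic hU hU'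
    obtain ⟨b, rfl⟩ := exists_eq_basic hV hV'
    rw [setRdiv_basic]
    exact isClopen_basic _
  exists_of_notMem_circ F G H h := by
    rw [mem_circ] at h
    push Not at h
    obtain ⟨a, ha, b, hb, hab⟩ := h
    refine ⟨basic a, basic b, isClopen_basic a, (basicClopen a).upper, isClopen_basic b,
      (basicClopen b).upper, ha, hb, ?_⟩
    rw [setCirc_basic]
    exact hab

end GBI

/-! ### Preimages of prime filters under GBI-homomorphisms -/

section Comap

variable {A B : Type u} [HeytingAlgebra A] [GBIOps A] [HeytingAlgebra B] [GBIOps B]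
  {h : A → B}

theorem comap_mono (hh : IsGBIHom h) {F G : PrimeFilter B} (hFG : F ≤ G) :
    comap hh F ≤ comap hh G := fun a ha => hFG (h a) ha

theorem continuous_comap (hh : IsGBIHom h) : Continuous (comap hh) := by
  refine continuous_generateFrom_iff.2 ?_
  rintro _ (⟨a, rfl⟩ | ⟨a, rfl⟩)
  · exact (isClopen_basic (h a)).isOpen
  · exact (isClopen_basic (h a)).compl.isOpen

/-- This is the back condition for the order. `F'` must contain `F` and `h[G]` and avoid `h` of the
complement of `G`. If `c ⊓ h a ≤ h a'` with `c ∈ F` and `a ∈ G`, preservation of `⇨` puts `a ⇨ a'`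
in the preimage of `F`, hence in `G`, which forces `a' ∈ G`. -/
theorem exists_comap_eq_of_comap_le (hh : IsGBIHom h) {F : PrimeFilter B} {G : PrimeFilter A}
    (hFG : comap hh F ≤ G) : ∃ F', F ≤ F' ∧ comap hh F' = G := by
  obtain ⟨F', hF', hI⟩ := exists_of_disjoint (PFilter.join F.1 (PFilter.map hh G.1))
    (Order.Ideal.map hh G.complIdeal) (by
      rintro b ⟨c, hc, d, ⟨a, ha, had⟩, hb⟩ ⟨a', ha', hba'⟩
      have hle : c ≤ h (a ⇨ a') := by
        rw [hh.map_himp, le_himp_iff]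
        exact (inf_le_inf_left c had).trans (hb.trans hba')
      have hG : (a ⇨ a') ⊓ a ∈ G :=
        inf_mem_iff.2 ⟨hFG _ ((mem_comap hh F _).2 (mem_of_le hle hc)), ha⟩
      exact ha' (mem_of_le himp_inf_le hG))
  refine ⟨F', fun c hc => hF' c (PFilter.mem_join.2
    ⟨c, hc, ⊤, PFilter.top_mem, inf_le_left⟩), ext fun a => ⟨fun ha => ?_, fun ha => ?_⟩⟩
  · by_contra haG
    exact hI (h a) (Order.Ideal.mem_map.2 ⟨a, haG, le_rfl⟩) ha
  · exact hF' (h a) (PFilter.mem_join.2 ⟨⊤, PFilter.top_mem, h a,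
      PFilter.mem_map.2 ⟨a, ha, le_rfl⟩, inf_le_right⟩)

theorem isGBIPMorphism_comap [GBIAlgebra A] [GBIAlgebra B] (hh : IsGBIHom h) :
    IsGBIPMorphism (comap hh) where
  continuous := continuous_comap hh
  image_Ici F := by
    ext G
    constructor
    · intro hG
      obtain ⟨F', hF', rfl⟩ := exists_comap_eq_of_comap_le hh hG
      exact ⟨F', hF', rfl⟩
    · rintro ⟨F', hF', rfl⟩
      exact comap_mono hh hF'
  map_circ F G H hH := mem_circ.2 fun a ha b hb => by
    rw [mem_comap, hh.map_mul]
    exact mem_circ.1 hH _ ha _ hb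
  exists_of_map_mem H F G hH := by
    obtain ⟨F', G', hF, hG, hH'⟩ := exists_mem_circ_le (PFilter.map hh F.1) (PFilter.map hh G.1) H
      (by
        rintro b ⟨a, ha, hab⟩ b' ⟨a', ha', hab'⟩
        refine mem_of_le (GBIAlgebra.mul_mono hab hab') ?_
        rw [← hh.map_mul]
        exact mem_circ.1 hH a ha a' ha')
    exact ⟨F', G', fun a ha => hF _ (PFilter.mem_map.2 ⟨a, ha, le_rfl⟩),
      fun a ha => hG _ (PFilter.mem_map.2 ⟨a, ha, le_rfl⟩), hH'⟩
  exists_of_mem_left F G H hH := by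
    -- Avoiding the image of the complement of `H` forces the preimage of `H'` below `H`.
    -- Disjointness uses the right residual: `b * h a ≤ h c` gives `b ≤ h (c / a)`, and then `(c /
    -- a) * a ∈ H`. The left residual plays this role in the mirrored clause.
    obtain ⟨F', G', H', hF, hG, hH', hI⟩ := exists_mem_circ F.1 (PFilter.map hh G.1)
      (Order.Ideal.map hh H.complIdeal) (by
        rintro b hb d ⟨a, ha, had⟩ ⟨c, hc, hbd⟩
        have hle : b ≤ h (GBIOps.rdiv c a) := by
          rw [hh.map_rdiv, ← GBIAlgebra.mul_le_iff_le_rdiv]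
          exact (GBIAlgebra.mul_le_mul_right_of_le b had).trans hbd
        exact hc (mem_of_le (GBIAlgebra.rdiv_mul_le a c)
          (mem_circ.1 hH _ ((mem_comap hh F _).2 (mem_of_le hle hb)) a ha)))
    refine ⟨G', H', fun a ha => hG _ (PFilter.mem_map.2 ⟨a, ha, le_rfl⟩), fun a ha => ?_,
      circ_mono hF le_rfl le_rfl hH'⟩
    by_contra haH
    exact hI (h a) (Order.Ideal.mem_map.2 ⟨a, haH, le_rfl⟩) ha
  exists_of_mem_right G F H hH := by
    obtain ⟨F', G', H', hF, hG, hH', hI⟩ := exists_mem_circ (PFilter.map hh F.1) G.1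
      (Order.Ideal.map hh H.complIdeal) (by
        rintro d ⟨a, ha, had⟩ b hb ⟨c, hc, hbd⟩
        have hle : b ≤ h (GBIOps.ldiv a c) := by
          rw [hh.map_ldiv, ← GBIAlgebra.mul_le_iff_le_ldiv]
          exact (GBIAlgebra.mul_le_mul_left_of_le b had).trans hbd
        exact hc (mem_of_le (GBIAlgebra.mul_ldiv_le a c)
          (mem_circ.1 hH a ha _ ((mem_comap hh G _).2 (mem_of_le hle hb)))))
    refine ⟨F', H', fun a ha => hF _ (PFilter.mem_map.2 ⟨a, ha, le_rfl⟩), fun a ha => ?_,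
      circ_mono le_rfl hG le_rfl hH'⟩
    by_contra haH
    exact hI (h a) (Order.Ideal.mem_map.2 ⟨a, haH, le_rfl⟩) ha
  preimage_E := by
    ext F
    change 1 ∈ F ↔ h 1 ∈ F
    rw [hh.map_one]

end Comap

end PrimeFilter

/-! ### The GBI-algebra of clopen upsets of a GBI-space -/

namespace ClopenUpperSet

open GBIFrame

section Algebra

variable {P : Type u} [PartialOrder P] [TopologicalSpace P] [GBIFrame P] [GBISpace P]

theorem mem_mul {U V : ClopenUpperSet P} {z : P} :
    z ∈ U * V ↔ ∃ x ∈ U, ∃ y ∈ V, z ∈ circ x y := by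
  change z ∈ setMul (U : Set P) V ↔ _
  have h : setMul (U : Set P) V = setCirc (U : Set P) V := (isUpperSet_setCirc _ _).upperClosure
  rw [h, mem_setCirc]
  rfl

theorem coe_mul (U V : ClopenUpperSet P) : ((U * V : ClopenUpperSet P) : Set P) = setCirc U V := by
  ext z
  exact mem_mul.trans mem_setCirc.symm

theorem mem_ldiv {U V : ClopenUpperSet P} {z : P} :
    z ∈ GBIOps.ldiv U V ↔ ∀ x ∈ U, ∀ w ∈ circ x z, w ∈ V :=
  mem_setLdiv

theorem mem_rdiv {U V : ClopenUpperSet P} {z : P} :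
    z ∈ GBIOps.rdiv U V ↔ ∀ y ∈ V, ∀ w ∈ circ z y, w ∈ U :=
  mem_setRdiv

theorem mem_himp {U V : ClopenUpperSet P} {x : P} :
    x ∈ U ⇨ V ↔ ∀ y, x ≤ y → y ∈ U → y ∈ V := by
  change x ∈ ((lowerClosure ((U : Set P) \ V) : LowerSet P) : Set P)ᶜ ↔ _
  simp only [Set.mem_compl_iff, SetLike.mem_coe, mem_lowerClosure, Set.mem_sdiff]
  constructor
  · intro h y hxy hy
    by_contra hyV
    exact h ⟨y, ⟨hy, hyV⟩, hxy⟩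
  · rintro h ⟨y, ⟨hy, hyV⟩, hxy⟩
    exact hyV (h y hxy hy)

theorem exists_circ_circ_iff {x y z w : P} :
    (∃ t ∈ circ x y, w ∈ circ t z) ↔ ∃ t ∈ circ y z, w ∈ circ x t := by
  have h := Set.ext_iff.1 (GBISpace.circ_assoc x y z) w
  simpa only [mem_setCirc, Set.mem_singleton_iff, exists_eq_left] using h

instance : GBIAlgebra (ClopenUpperSet P) where
  mul_assoc U V W := by
    refine SetLike.ext fun w => ?_
    simp only [mem_mul]
    constructor
    · rintro ⟨t, ⟨x, hx, y, hy, ht⟩, z, hz, hw⟩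
      obtain ⟨t, ht, hw⟩ := exists_circ_circ_iff.1 ⟨t, ht, hw⟩
      exact ⟨x, hx, t, ⟨y, hy, z, hz, ht⟩, hw⟩
    · rintro ⟨x, hx, t, ⟨y, hy, z, hz, ht⟩, hw⟩
      obtain ⟨t, ht, hw⟩ := exists_circ_circ_iff.2 ⟨t, ht, hw⟩
      exact ⟨t, ⟨x, hx, y, hy, ht⟩, z, hz, hw⟩
  one_mul U := SetLike.coe_injective <|
    (coe_mul 1 U).trans (GBISpace.E_circ _ U.isClopen U.upper)
  mul_one U := SetLike.coe_injective <|
    (coe_mul U 1).trans (GBISpace.circ_E _ U.isClopen U.upper)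
  mul_le_iff_le_ldiv U V W := by
    constructor
    · exact fun h y hy => mem_ldiv.2 fun x hx w hw => h (mem_mul.2 ⟨x, hx, y, hy, hw⟩)
    · intro h w hw
      obtain ⟨x, hx, y, hy, hw⟩ := mem_mul.1 hw
      exact mem_ldiv.1 (h hy) x hx w hw
  mul_le_iff_le_rdiv U V W := by
    constructor
    · exact fun h x hx => mem_rdiv.2 fun y hy w hw => h (mem_mul.2 ⟨x, hx, y, hy, hw⟩)
    · intro h w hw
      obtain ⟨x, hx, y, hy, hw⟩ := mem_mul.1 hw
      exact mem_rdiv.1 (h hx) y hy w hw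

end Algebra

/-! ### Preimages of clopen upsets under GBI-p-morphisms -/

section Comap

variable {P Q : Type u} [PartialOrder P] [TopologicalSpace P] [GBIFrame P]
  [PartialOrder Q] [TopologicalSpace Q] [GBIFrame Q] {f : P → Q}

theorem mem_comap {hf : IsGBIPMorphism f} {V : ClopenUpperSet Q} {x : P} :
    x ∈ comap hf V ↔ f x ∈ V := Iff.rfl

/-- Each operation uses its own back condition: `image_Ici` for `⇨`, `exists_of_map_mem` for the
product, `exists_of_mem_right` for `\` and `exists_of_mem_left` for `/`. The witnesses are only
comparable to the given points, which suffices for upsets. -/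
theorem isGBIHom_comap [GBISpace P] [GBISpace Q] (hf : IsGBIPMorphism f) :
    IsGBIHom (comap hf) where
  map_inf _ _ := rfl
  map_sup _ _ := rfl
  map_bot := rfl
  map_himp U V := by
    refine SetLike.ext fun x => ?_
    rw [mem_comap, mem_himp, mem_himp]
    constructor
    · exact fun h y hxy hy => h (f y) (hf.monotone hxy) hy
    · intro h q hq hqU
      obtain ⟨y, hxy, rfl⟩ : q ∈ f '' Set.Ici x := hf.image_Ici x ▸ hq
      exact h y hxy hqU
  map_mul U V := by
    refine SetLike.ext fun z => ?_
    rw [mem_comap, mem_mul, mem_mul]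
    constructor
    · rintro ⟨u, hu, v, hv, hz⟩
      obtain ⟨x, y, hx, hy, hz⟩ := hf.exists_of_map_mem z u v hz
      exact ⟨x, U.upper hx hu, y, V.upper hy hv, hz⟩
    · rintro ⟨x, hx, y, hy, hz⟩
      exact ⟨f x, hx, f y, hy, hf.map_circ x y z hz⟩
  map_ldiv U V := by
    refine SetLike.ext fun y => ?_
    rw [mem_comap, mem_ldiv, mem_ldiv]
    constructor
    · exact fun h x hx z hz => h (f x) hx (f z) (hf.map_circ x y z hz)
    · intro h u hu w hw
      obtain ⟨x, z, hx, hz, hxz⟩ := hf.exists_of_mem_right y u w hw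
      exact V.upper hz (h x (U.upper hx hu) z hxz)
  map_rdiv U V := by
    refine SetLike.ext fun x => ?_
    rw [mem_comap, mem_rdiv, mem_rdiv]
    constructor
    · exact fun h y hy z hz => h (f y) hy (f z) (hf.map_circ x y z hz)
    · intro h v hv w hw
      obtain ⟨y, z, hy, hz, hyz⟩ := hf.exists_of_mem_left x v w hw
      exact U.upper hz (h y (V.upper hy hv) z hyz)
  map_one := SetLike.coe_injective hf.preimage_E.symm

end Comap

/-! ### The points of a GBI-space as prime filters of clopen upsets -/

section Point

variable {P : Type u} [PartialOrder P] [TopologicalSpace P]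

theorem mem_pointFilter {U : ClopenUpperSet P} {x : P} : U ∈ pointFilter x ↔ x ∈ U := Iff.rfl

theorem pointFilter_le_iff [PriestleySpace P] {x y : P} :
    pointFilter x ≤ pointFilter y ↔ x ≤ y := by
  refine ⟨fun h => ?_, fun h U hU => U.upper h hU⟩
  by_contra hxy
  obtain ⟨U, hU, hU', hx, hy⟩ := exists_isClopen_upper_of_not_le hxy
  exact hy (h ⟨⟨U, hU⟩, hU'⟩ hx)

theorem pointFilter_injective [PriestleySpace P] :
    Function.Injective (pointFilter : P → PrimeFilter (ClopenUpperSet P)) := fun _ _ h =>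
  le_antisymm (pointFilter_le_iff.1 h.le) (pointFilter_le_iff.1 h.ge)

theorem continuous_pointFilter :
    Continuous (pointFilter : P → PrimeFilter (ClopenUpperSet P)) := by
  refine continuous_generateFrom_iff.2 ?_
  rintro _ (⟨U, rfl⟩ | ⟨U, rfl⟩)
  · exact U.isClopen.isOpen
  · exact U.isClopen.compl.isOpen

/-- The required point lies in every `U ∈ F` and outside every `V ∉ F`. The sets `U \ V` are closed,
form a directed family because `F` is prime, and are nonempty since `U ≤ V` would put `V` in `F`;
compactness gives a common point. -/
theorem pointFilter_surjective [EsakiaSpace P] :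
    Function.Surjective (pointFilter : P → PrimeFilter (ClopenUpperSet P)) := by
  intro F
  let ι := {p : ClopenUpperSet P × ClopenUpperSet P // p.1 ∈ F ∧ p.2 ∉ F}
  have : Nonempty ι := ⟨⟨(⊤, ⊥), PrimeFilter.top_mem F, PrimeFilter.bot_notMem F⟩⟩
  have hclopen : ∀ i : ι, IsClopen ((i.1.1 : Set P) \ i.1.2) := fun i =>
    i.1.1.isClopen.diff i.1.2.isClopen
  obtain ⟨x, hx⟩ := IsCompact.nonempty_iInter_of_directed_nonempty_isCompact_isClosed
    (fun i : ι => (i.1.1 : Set P) \ i.1.2)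
    (fun i j => ⟨⟨(i.1.1 ⊓ j.1.1, i.1.2 ⊔ j.1.2), PrimeFilter.inf_mem_iff.2 ⟨i.2.1, j.2.1⟩,
        fun h => (PrimeFilter.sup_mem_iff.1 h).elim i.2.2 j.2.2⟩,
      fun x hx => ⟨hx.1.1, fun h => hx.2 (Or.inl h)⟩,
      fun x hx => ⟨hx.1.2, fun h => hx.2 (Or.inr h)⟩⟩)
    (fun i => Set.nonempty_of_not_subset fun h => i.2.2 (PrimeFilter.mem_of_le h i.2.1))
    (fun i => (hclopen i).isClosed.isCompact) (fun i => (hclopen i).isClosed)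
  rw [Set.mem_iInter] at hx
  refine ⟨x, PrimeFilter.ext fun U => ⟨fun hU => ?_, fun hU => ?_⟩⟩
  · by_contra hUF
    exact (hx ⟨(⊤, U), PrimeFilter.top_mem F, hUF⟩).2 hU
  · exact (hx ⟨(U, ⊥), hU, PrimeFilter.bot_notMem F⟩).1

/-- A GBI-space is homeomorphic to the space of prime filters of its clopen upsets. -/
noncomputable def pointFilterHomeomorph (P : Type u) [PartialOrder P] [TopologicalSpace P]
    [EsakiaSpace P] : P ≃ₜ PrimeFilter (ClopenUpperSet P) :=
  -- A continuous bijection from a compact space to a Hausdorff one has a continuous inverse.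
  Continuous.homeoOfEquivCompactToT2
    (f := Equiv.ofBijective pointFilter ⟨pointFilter_injective, pointFilter_surjective⟩)
    continuous_pointFilter

/-- Reflection of the relation is exactly what the separation axiom `exists_of_notMem_circ`
provides. -/
theorem pointFilter_mem_circ_iff [GBIFrame P] [GBISpace P] {x y z : P} :
    pointFilter z ∈ circ (pointFilter x) (pointFilter y) ↔ z ∈ circ x y := by
  rw [PrimeFilter.mem_circ]
  constructor
  · intro h
    by_contra hz
    obtain ⟨U, V, hU, hU', hV, hV', hx, hy, hz⟩ := GBISpace.exists_of_notMem_circ x y z hz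
    have := h ⟨⟨U, hU⟩, hU'⟩ hx ⟨⟨V, hV⟩, hV'⟩ hy
    rw [mem_pointFilter, mem_mul] at this
    exact hz (mem_setCirc.2 this)
  · exact fun hz U hU V hV => mem_mul.2 ⟨x, hU, y, hV, hz⟩

end Point

end ClopenUpperSet

/-! ### Isomorphisms -/

/-- The inverse of a bijective GBI-homomorphism is a GBI-homomorphism. -/
theorem IsGBIHom.symm {A B : Type u} [HeytingAlgebra A] [GBIOps A] [HeytingAlgebra B] [GBIOps B]
    {e : A ≃ B} (he : IsGBIHom e) : IsGBIHom e.symm where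
  map_inf x y := by simp [e.symm_apply_eq, he.map_inf]
  map_sup x y := by simp [e.symm_apply_eq, he.map_sup]
  map_himp x y := by simp [e.symm_apply_eq, he.map_himp]
  map_bot := by simp [e.symm_apply_eq, he.map_bot]
  map_mul x y := by simp [e.symm_apply_eq, he.map_mul]
  map_ldiv x y := by simp [e.symm_apply_eq, he.map_ldiv]
  map_rdiv x y := by simp [e.symm_apply_eq, he.map_rdiv]
  map_one := by simp [e.symm_apply_eq, he.map_one]

/-- A homeomorphism that preserves and reflects `≤`, `∘` and `E` is a GBI-p-morphism. -/
theorem IsGBIPMorphism.of_homeomorph {P Q : Type u} [PartialOrder P] [TopologicalSpace P]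
    [GBIFrame P] [PartialOrder Q] [TopologicalSpace Q] [GBIFrame Q] (e : P ≃ₜ Q)
    (hle : ∀ x y, e x ≤ e y ↔ x ≤ y)
    (hcirc : ∀ x y z, e z ∈ GBIFrame.circ (e x) (e y) ↔ z ∈ GBIFrame.circ x y)
    (hE : ∀ x, e x ∈ (GBIFrame.E : Set Q) ↔ x ∈ (GBIFrame.E : Set P)) : IsGBIPMorphism e where
  continuous := e.continuous
  image_Ici p := by
    ext q
    obtain ⟨q, rfl⟩ := e.surjective q
    simp [hle]
  map_circ x y z h := (hcirc x y z).2 h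
  exists_of_map_mem z u v h := by
    obtain ⟨x, rfl⟩ := e.surjective u
    obtain ⟨y, rfl⟩ := e.surjective v
    exact ⟨x, y, le_rfl, le_rfl, (hcirc x y z).1 h⟩
  exists_of_mem_left x v w h := by
    obtain ⟨y, rfl⟩ := e.surjective v
    obtain ⟨z, rfl⟩ := e.surjective w
    exact ⟨y, z, le_rfl, le_rfl, (hcirc x y z).1 h⟩
  exists_of_mem_right y u w h := by
    obtain ⟨x, rfl⟩ := e.surjective u
    obtain ⟨z, rfl⟩ := e.surjective w
    exact ⟨x, z, le_rfl, le_rfl, (hcirc x y z).1 h⟩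
  preimage_E := Set.ext fun x => (hE x).symm

/-! ### The point map is an isomorphism of GBI-spaces -/

namespace ClopenUpperSet

variable {P : Type u} [PartialOrder P] [TopologicalSpace P] [GBIFrame P] [GBISpace P]

theorem isGBIPMorphism_pointFilter : IsGBIPMorphism (pointFilterHomeomorph P) :=
  .of_homeomorph _ (fun _ _ => pointFilter_le_iff) (fun _ _ _ => pointFilter_mem_circ_iff)
    fun _ => Iff.rfl

theorem isGBIPMorphism_pointFilter_symm : IsGBIPMorphism (pointFilterHomeomorph P).symm := by
  refine .of_homeomorph _ (fun F G => ?_) (fun F G H => ?_) (fun F => ?_)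
  · obtain ⟨x, rfl⟩ := (pointFilterHomeomorph P).surjective F
    obtain ⟨y, rfl⟩ := (pointFilterHomeomorph P).surjective G
    simp only [Homeomorph.symm_apply_apply]
    exact pointFilter_le_iff.symm
  · obtain ⟨x, rfl⟩ := (pointFilterHomeomorph P).surjective F
    obtain ⟨y, rfl⟩ := (pointFilterHomeomorph P).surjective G
    obtain ⟨z, rfl⟩ := (pointFilterHomeomorph P).surjective H
    simp only [Homeomorph.symm_apply_apply]
    exact pointFilter_mem_circ_iff.symm
  · obtain ⟨x, rfl⟩ := (pointFilterHomeomorph P).surjective F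
    simp only [Homeomorph.symm_apply_apply]
    exact Iff.rfl

end ClopenUpperSet

/-! ### The representation map is an isomorphism of GBI-algebras -/

namespace PrimeFilter

variable {A : Type u} [HeytingAlgebra A]

theorem basicClopen_bijective :
    Function.Bijective (basicClopen : A → ClopenUpperSet (PrimeFilter A)) := by
  refine ⟨fun a b h => ?_, fun U => ?_⟩
  · have h' : basic a = basic b := SetLike.ext'_iff.1 h
    exact le_antisymm (basic_subset_iff.1 h'.le) (basic_subset_iff.1 h'.ge)
  · obtain ⟨a, ha⟩ := exists_eq_basic U.isClopen U.upper
    exact ⟨a, SetLike.coe_injective ha.symm⟩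

theorem isGBIHom_basicClopen [GBIOps A] [GBIAlgebra A] :
    IsGBIHom (basicClopen : A → ClopenUpperSet (PrimeFilter A)) where
  map_inf a b := SetLike.coe_injective (basic_inf a b)
  map_sup a b := SetLike.coe_injective (basic_sup a b)
  map_himp a b := SetLike.coe_injective (basic_himp a b)
  map_bot := SetLike.coe_injective basic_bot
  map_mul a b := SetLike.coe_injective <|
    (setCirc_basic a b).symm.trans (ClopenUpperSet.coe_mul (basicClopen a) (basicClopen b)).symm
  map_ldiv a b := SetLike.coe_injective (setLdiv_basic a b).symm
  map_rdiv a b := SetLike.coe_injective (setRdiv_basic a b).symm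
  map_one := rfl

/-- `a ↦ ℱ_a` as a bijection onto the clopen upsets of the space of prime filters. -/
noncomputable def basicClopenEquiv (A : Type u) [HeytingAlgebra A] :
    A ≃ ClopenUpperSet (PrimeFilter A) :=
  Equiv.ofBijective basicClopen basicClopen_bijective

theorem isGBIHom_basicClopenEquiv [GBIOps A] [GBIAlgebra A] : IsGBIHom (basicClopenEquiv A) :=
  isGBIHom_basicClopen

end PrimeFilter

/-! ### The dual equivalence -/

/-- The functor of prime filters. -/
abbrev primeFilters : GBIAlg.{u} ⥤ GBISp.{u}ᵒᵖ :=
  primeFilterFunctor (fun _ => inferInstance) fun _ _ h => PrimeFilter.isGBIPMorphism_comap h.isHom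

/-- The functor of clopen upsets. -/
abbrev clopenUpsets : GBISp.{u}ᵒᵖ ⥤ GBIAlg.{u} :=
  clopenUpsetFunctor (fun _ => inferInstance)
    fun _ _ f => ClopenUpperSet.isGBIHom_comap f.isPMorphism

/-- `a ↦ ℱ_a` as an isomorphism of GBI-algebras. -/
noncomputable def basicClopenIso (A : GBIAlg.{u}) :
    A ≅ clopenUpsets.obj (primeFilters.obj A) where
  hom := ⟨PrimeFilter.basicClopenEquiv A, PrimeFilter.isGBIHom_basicClopenEquiv⟩
  inv := ⟨(PrimeFilter.basicClopenEquiv A).symm, PrimeFilter.isGBIHom_basicClopenEquiv.symm⟩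
  hom_inv_id := GBIHom.ext (funext fun a => (PrimeFilter.basicClopenEquiv A).symm_apply_apply a)
  inv_hom_id := GBIHom.ext (funext fun U => (PrimeFilter.basicClopenEquiv A).apply_symm_apply U)

/-- `x ↦ {U : x ∈ U}` as an isomorphism of GBI-spaces. -/
noncomputable def pointFilterIso (P : GBISp.{u}) :
    P ≅ (primeFilters.obj (clopenUpsets.obj (op P))).unop where
  hom := ⟨ClopenUpperSet.pointFilterHomeomorph P, ClopenUpperSet.isGBIPMorphism_pointFilter⟩
  inv := ⟨(ClopenUpperSet.pointFilterHomeomorph P).symm,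
    ClopenUpperSet.isGBIPMorphism_pointFilter_symm⟩
  hom_inv_id := GBIPMorphism.ext
    (funext fun x => (ClopenUpperSet.pointFilterHomeomorph P).symm_apply_apply x)
  inv_hom_id := GBIPMorphism.ext
    (funext fun F => (ClopenUpperSet.pointFilterHomeomorph P).apply_symm_apply F)

/-- The natural isomorphism `a ↦ ℱ_a`. -/
noncomputable def basicClopenNatIso : 𝟭 GBIAlg.{u} ≅ primeFilters ⋙ clopenUpsets :=
  -- Naturality is definitional: both composites send `a` to the set of prime filters containing `h
  -- a`.
  NatIso.ofComponents basicClopenIso fun _ => rfl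

/-- The natural isomorphism `x ↦ {U : x ∈ U}`. -/
noncomputable def pointFilterNatIso : clopenUpsets ⋙ primeFilters ≅ 𝟭 GBISp.{u}ᵒᵖ :=
  NatIso.ofComponents (fun P => (pointFilterIso P.unop).op) fun _ => rfl


theorem mainTheorem1 :
    -- (i) and (ii): the dual objects are GBI-spaces and GBI-algebras
    ∃ (hF : ∀ A : GBIAlg.{u}, GBISpace (PrimeFilter A))
      (hU : ∀ P : GBISp.{u}, GBIAlgebra (ClopenUpperSet P))
    -- the dual maps are morphisms
      (hF' : ∀ (A B : GBIAlg.{u}) (h : A ⟶ B), IsGBIPMorphism (PrimeFilter.comap h.isHom))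
      (hU' : ∀ (P Q : GBISp.{u}) (f : P ⟶ Q), IsGBIHom (ClopenUpperSet.comap f.isPMorphism)),
      let Fp : GBIAlg.{u} ⥤ GBISp.{u}ᵒᵖ := primeFilterFunctor hF hF'
      let Uc : GBISp.{u}ᵒᵖ ⥤ GBIAlg.{u} := clopenUpsetFunctor hU hU'
      -- (iii): both round trips are isomorphisms
      (∀ A : GBIAlg.{u}, Nonempty (Uc.obj (Fp.obj A) ≅ A)) ∧
      (∀ P : GBISp.{u}, Nonempty ((Fp.obj (Uc.obj (op P))).unop ≅ P)) ∧
      -- (iv): they are natural, by `a ↦ {F | a ∈ F}` and `x ↦ {U | x ∈ U}`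
      (∃ η : 𝟭 GBIAlg.{u} ≅ Fp ⋙ Uc, ∀ (A : GBIAlg.{u}) (a : A),
        GBIHom.toFun (η.hom.app A) a = PrimeFilter.basicClopen a) ∧
      (∃ ε : Uc ⋙ Fp ≅ 𝟭 GBISp.{u}ᵒᵖ, ∀ (P : GBISp.{u}) (x : P),
        GBIPMorphism.toFun (ε.hom.app (op P)).unop x = ClopenUpperSet.pointFilter x) ∧
      -- and the two functors form a dual equivalence
      (∃ e : GBIAlg.{u} ≌ GBISp.{u}ᵒᵖ, e.functor = Fp ∧ e.inverse = Uc) := by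
  refine ⟨fun _ => inferInstance, fun _ => inferInstance,
    fun _ _ h => PrimeFilter.isGBIPMorphism_comap h.isHom,
    fun _ _ f => ClopenUpperSet.isGBIHom_comap f.isPMorphism,
    fun A => ⟨(basicClopenIso A).symm⟩, fun P => ⟨(pointFilterIso P).symm⟩,
    ⟨basicClopenNatIso, fun _ _ => rfl⟩, ⟨pointFilterNatIso, fun _ _ => rfl⟩,
    -- No triangle identity has to be checked, since `Equivalence.mk` adjusts the unit and keeps
    -- both functors unchanged.
    ⟨CategoryTheory.Equivalence.mk primeFilters clopenUpsets basicClopenNatIso pointFilterNatIso,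
      rfl, rfl⟩⟩
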